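/- All graphs are finite, simple and undirected. The spectral radius $\rho(G)$ of a graph $G$ is the largest absolute value of an eigenvalue of its adjacency matrix, and the size of $G$ is its number of edges. Let $H(4,3)$ be the graph on six vertices formed by a cycle of length $4$ and a triangle sharing exactly one vertex. A graph is $H(4,3)$-free if it contains no (not necessarily induced) subgraph isomorphic to $H(4,3)$. For $n\ge 3$, let $S_{n,2}=K_2\vee (n-2)K_1$ be the graph of order $n$ obtained by joining each vertex of $K_2$ to each of $n-2$ further, pairwise non-adjacent vertices, and let $S_{n,2}^{-}$ be the graph obtained from $S_{n,2}$ by deleting one edge between a vertex of the $K_2$ and one of these $n-2$ vertices. **Theorem.** Let $m\ge 38$ be even and let $G$ be an $H(4,3)$-free graph of size $m$ without isolated vertices. Let $\rho'(m)$ be the largest real root of $x^4-mx^2-(m-2)x+\frac m2-1$. Then $\rho(G)\le\rho'(m)$, with equality if and only if $G\cong S_{\frac{m+4}{2},2}^{-}$. -/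

import Mathlib

/-- The spectral radius of a finite graph: the maximum modulus of the eigenvalues of its
(real symmetric) adjacency matrix. -/
noncomputable def graphSpectralRadius {V : Type*} [Fintype V] [DecidableEq V]
    (G : SimpleGraph V) [DecidableRel G.Adj] : ℝ :=
  (spectralRadius ℝ (G.adjMatrix ℝ)).toReal

/-- The graph `H(4,3)`: the 4-cycle `0 1 2 3` and the triangle `0 4 5`, sharing exactly the
vertex `0`. -/
def graphH43 : SimpleGraph (Fin 6) :=
  SimpleGraph.fromEdgeSet
    {s(0, 1), s(1, 2), s(2, 3), s(3, 0), s(0, 4), s(4, 5), s(5, 0)}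

/-- The join `G ∨ H` of two graphs: their disjoint union together with all edges between them. -/
def graphJoin {V W : Type*} (G : SimpleGraph V) (H : SimpleGraph W) : SimpleGraph (V ⊕ W) :=
  (G ⊕g H) ⊔ completeBipartiteGraph V W

/-- The graph `S_{n,2} = K₂ ∨ (n-2)K₁` of order `n` (used for `n ≥ 2`). -/
def graphS2 (n : ℕ) : SimpleGraph (Fin 2 ⊕ Fin (n - 2)) :=
  graphJoin ⊤ ⊥

/-- The graph `S⁻_{n,2}` (used for `n ≥ 3`): delete from `S_{n,2}` the edge joining one vertex of
the `K₂` to the first of the remaining `n - 2` vertices, which all have degree two. -/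
def graphS2Minus (n : ℕ) : SimpleGraph (Fin 2 ⊕ Fin (n - 2)) :=
  (graphS2 n).deleteEdges {e | ∃ i : Fin (n - 2), i.val = 0 ∧ e = s(Sum.inl 0, Sum.inr i)}

/-- The real roots of `x⁴ - m x² - (m-2) x + m/2 - 1`. -/
def rhoPrimeRoots (m : ℕ) : Set ℝ :=
  {x | x ^ 4 - (m : ℝ) * x ^ 2 - ((m : ℝ) - 2) * x + (m : ℝ) / 2 - 1 = 0}

/-- `ρ'(m)`, the largest real root of `x⁴ - m x² - (m-2) x + m/2 - 1`. -/
noncomputable def rhoPrime (m : ℕ) : ℝ := sSup (rhoPrimeRoots m)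

/-- For `m ≥ 2` the largest root exists, so `rhoPrime m` really is the largest root. -/
theorem rhoPrime_isGreatest (m : ℕ) (hm : 2 ≤ m) :
    IsGreatest (rhoPrimeRoots m) (rhoPrime m) := by
  have hm' : (2 : ℝ) ≤ (m : ℝ) := by exact_mod_cast hm
  have hclosed : IsClosed (rhoPrimeRoots m) :=
    isClosed_eq (by fun_prop) continuous_const
  have hbdd : BddAbove (rhoPrimeRoots m) := by
    refine ⟨2 * (m : ℝ), fun x hx => ?_⟩
    by_contra! hlt
    have hx0 : x ^ 4 - (m : ℝ) * x ^ 2 - ((m : ℝ) - 2) * x + (m : ℝ) / 2 - 1 = 0 := hx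
    have h4 : 4 < x := by linarith
    have h1 : 0 < (x - 2 * m) * x := mul_pos (by linarith) (by linarith)
    have h2 : 0 < ((x - 2 * m) * x) * x ^ 2 := by positivity
    have h3 : 0 < (m : ℝ) * (x ^ 2 * (x - 1)) := by
      have : 0 < x - 1 := by linarith
      positivity
    have h5 : 0 < (m : ℝ) * (x * (x ^ 2 - 1)) := by
      have : 0 < x ^ 2 - 1 := by nlinarith
      positivity
    nlinarith
  have hne : (rhoPrimeRoots m).Nonempty := by
    have hc : ContinuousOn (fun x : ℝ =>
        x ^ 4 - (m : ℝ) * x ^ 2 - ((m : ℝ) - 2) * x + (m : ℝ) / 2 - 1) (Set.Icc 0 1) := by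
      fun_prop
    obtain ⟨x, -, hx⟩ := intermediate_value_Icc' (zero_le_one' ℝ) hc
      (show (0 : ℝ) ∈ Set.Icc _ _ from ⟨by norm_num; linarith, by norm_num; linarith⟩)
    exact ⟨x, hx⟩
  exact ⟨hclosed.csSup_mem hne hbdd, fun x hx => le_csSup hbdd hx⟩

/-! Suppose `ρ(G) ≥ ρ'(m)`, put `r = ρ(G)` and take a nonnegative eigenvector `x` with largest entry
`1` at `u`. Let `N` be the neighbourhood of `u` and `W` the set of vertices outside `N ∪ {u}`. Since
`ρ'(m)` exceeds the positive root of `t² - t = m - 2`, we have `r² - r > m - 2` (`rhoPrime_gap`).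
Comparing `r² x_u`, a weighted count of 2-walks from `u`, with the number of edges gives
`key_inequality`: `e(N) + e(W) + ∑_W d_N(w)(1 - x_w) + r < 2 + ∑_N d_N(v) x_v`.

As `G` is `H(4,3)`-free, `G[N]` contains no path on three vertices with a disjoint edge. As `e(N) >
9/2`, the maximum degree of `G[N]` is pushed up to at least 4 (`exists_four_le_degIn`); the delicate
competitor, a dense component on four vertices, falls to `false_of_diamond`. So `G[N]` is a star
with centre `v` plus isolated vertices.

The key inequality then leaves total defect below 1, which forces `W` to have at most one vertex,
with a single edge to `N`. In each remaining configuration the eigenvalue equations are solved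
explicitly: either `G` is extremal, or the quartic is negative at `r`, impossible for `r ≥ ρ'(m)`
(`isBookWithPendant_or_of_four_le`).

For the extremal graph, eliminating variables shows that `r` is a root of the quartic, so `r ≤
ρ'(m)`; an explicit eigenvector gives the reverse bound. -/

set_option linter.unusedSectionVars false

/-! ### Copies of `H(4,3)`, and Perron-type eigenvectors -/

/-- A four-cycle `c p₁ p₂ p₃` and a triangle `c q₁ q₂` sharing only `c` form a copy of `H(4,3)`. -/
theorem not_free_of_cycle_triangle {V : Type*} {G : SimpleGraph V} {c p₁ p₂ p₃ q₁ q₂ : V}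
    (h1 : G.Adj c p₁) (h2 : G.Adj p₁ p₂) (h3 : G.Adj p₂ p₃) (h4 : G.Adj p₃ c)
    (h5 : G.Adj c q₁) (h6 : G.Adj q₁ q₂) (h7 : G.Adj q₂ c)
    (n1 : p₂ ≠ c) (n2 : p₁ ≠ p₃) (n3 : q₁ ≠ p₁) (n4 : q₁ ≠ p₂) (n5 : q₁ ≠ p₃)
    (n6 : q₂ ≠ p₁) (n7 : q₂ ≠ p₂) (n8 : q₂ ≠ p₃) : ¬ graphH43.Free G := by
  intro hfree
  apply hfree
  refine ⟨⟨⟨![c, p₁, p₂, p₃, q₁, q₂], ?_⟩, ?_⟩⟩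
  · intro i j hij
    fin_cases i <;> fin_cases j <;>
      simp [graphH43] at hij <;> simp [h1, h2, h3, h4, h5, h6, h7, h1.symm, h2.symm, h3.symm, h4.symm, h5.symm, h6.symm, h7.symm]
  · have e1 := h1.ne
    have e2 := h2.ne
    have e3 := h3.ne
    have e4 := h4.ne
    have e5 := h5.ne
    have e6 := h6.ne
    have e7 := h7.ne
    intro i j hij
    fin_cases i <;> fin_cases j <;> simp at hij ⊢ <;> grind

/-- The spectral radius of a graph on a nonempty vertex set is the modulus of an eigenvalue of
maximal modulus. -/
theorem exists_abs_eq_graphSpectralRadius {V : Type*} [Fintype V] [DecidableEq V] [Nonempty V]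
    (G : SimpleGraph V) [DecidableRel G.Adj] :
    ∃ μ ∈ spectrum ℝ (G.adjMatrix ℝ), |μ| = graphSpectralRadius G ∧
      ∀ ν ∈ spectrum ℝ (G.adjMatrix ℝ), |ν| ≤ graphSpectralRadius G := by
  have hA : (G.adjMatrix ℝ).IsHermitian := by
    rw [Matrix.IsHermitian, Matrix.conjTranspose_eq_transpose_of_trivial]
    exact G.isSymm_adjMatrix
  have hne : (spectrum ℝ (G.adjMatrix ℝ)).Nonempty :=
    ⟨_, hA.eigenvalues_mem_spectrum_real (Classical.arbitrary V)⟩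
  obtain ⟨μ, hμ, hmax⟩ := Set.exists_max_image (spectrum ℝ (G.adjMatrix ℝ)) (fun k => |k|)
    (Matrix.finite_real_spectrum) hne
  have hr : graphSpectralRadius G = |μ| := by
    have : spectralRadius ℝ (G.adjMatrix ℝ) = (‖μ‖₊ : ENNReal) := by
      apply le_antisymm
      · refine iSup₂_le fun k hk => ?_
        have := hmax k hk
        exact_mod_cast this
      · exact le_iSup₂ (f := fun (k : ℝ) (_ : k ∈ spectrum ℝ (G.adjMatrix ℝ)) =>
          (‖k‖₊ : ENNReal)) μ hμ
    rw [graphSpectralRadius, this]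
    simp
  exact ⟨μ, hμ, hr.symm, fun ν hν => hr ▸ hmax ν hν⟩

/-- A nonnegative eigenvector `x` for `r`, scaled to have its largest entry `1` at `u`. -/
structure IsPeakEigenvector {V : Type*} [Fintype V] (G : SimpleGraph V) [DecidableRel G.Adj]
    (r : ℝ) (x : V → ℝ) (u : V) : Prop where
  nonneg : ∀ v, 0 ≤ x v
  le_one : ∀ v, x v ≤ 1
  peak : x u = 1
  eig : ∀ v, r * x v = ∑ w ∈ G.neighborFinset v, x w

/-- Connectivity is not assumed. If `y` is an eigenvector for `μ` with `|μ| = r`, then `|y|`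
satisfies `r|y| ≤ A|y|` entrywise, so the positive semidefinite form of `r - A` vanishes at `|y|`,
and hence `|y|` lies in its kernel. -/
theorem exists_isPeakEigenvector {V : Type*} [Fintype V] [DecidableEq V] [Nonempty V]
    (G : SimpleGraph V) [DecidableRel G.Adj] :
    ∃ x u, IsPeakEigenvector G (graphSpectralRadius G) x u := by
  obtain ⟨μ, hμ, hμr, hall⟩ := exists_abs_eq_graphSpectralRadius G
  set r := graphSpectralRadius G with hr
  have hA : (G.adjMatrix ℝ).IsHermitian := by
    rw [Matrix.IsHermitian, Matrix.conjTranspose_eq_transpose_of_trivial]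
    exact G.isSymm_adjMatrix
  have hpsd : (algebraMap ℝ (Matrix V V ℝ) r - G.adjMatrix ℝ).PosSemidef := by
    rw [Matrix.posSemidef_iff_isHermitian_and_spectrum_nonneg]
    refine ⟨?_, ?_⟩
    · apply Matrix.IsHermitian.sub _ hA
      rw [Matrix.algebraMap_eq_diagonal]
      exact Matrix.isHermitian_diagonal _
    · intro t ht
      rw [← spectrum.singleton_sub_eq] at ht
      obtain ⟨s, hs, ν, hν, rfl⟩ := ht
      rw [Set.mem_singleton_iff] at hs
      have := (le_abs_self ν).trans (hall ν hν)
      change 0 ≤ s - ν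
      rw [hs]
      linarith
  rw [← Matrix.spectrum_toLin', ← Module.End.hasEigenvalue_iff_mem_spectrum] at hμ
  obtain ⟨y, hy⟩ := hμ.exists_hasEigenvector
  have hyeq : ∀ v, μ * y v = ∑ w ∈ G.neighborFinset v, y w := by
    intro v
    have := congrFun hy.apply_eq_smul v
    rw [Matrix.toLin'_apply, SimpleGraph.adjMatrix_mulVec_apply] at this
    rw [this]
    rfl
  let z : V → ℝ := fun v => |y v|
  have hz : ∀ v, r * z v ≤ ∑ w ∈ G.neighborFinset v, z w := by
    intro v
    calc r * z v = |μ * y v| := by rw [abs_mul, hμr]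
      _ ≤ _ := by rw [hyeq]; exact Finset.abs_sum_le_sum_abs _ _
  have hmv : ∀ v, ((algebraMap ℝ (Matrix V V ℝ) r - G.adjMatrix ℝ).mulVec z) v =
      r * z v - ∑ w ∈ G.neighborFinset v, z w := by
    intro v
    rw [Matrix.sub_mulVec, Pi.sub_apply, SimpleGraph.adjMatrix_mulVec_apply,
      Matrix.algebraMap_eq_diagonal, Matrix.mulVec_diagonal]
    rfl
  have hzero : (algebraMap ℝ (Matrix V V ℝ) r - G.adjMatrix ℝ).mulVec z = 0 := by
    rw [← hpsd.dotProduct_mulVec_zero_iff]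
    apply le_antisymm
    · apply Finset.sum_nonpos
      intro v _
      rw [hmv]
      apply mul_nonpos_of_nonneg_of_nonpos
      · exact abs_nonneg _
      · linarith [hz v]
    · exact hpsd.dotProduct_mulVec_nonneg z
  obtain ⟨u, -, hu⟩ := Finset.exists_max_image Finset.univ z Finset.univ_nonempty
  have hupos : 0 < z u := by
    by_contra! h
    apply hy.2
    funext v
    exact abs_eq_zero.mp (le_antisymm ((hu v (Finset.mem_univ v)).trans h) (abs_nonneg _))
  refine ⟨fun v => z v / z u, u, ?_, ?_, ?_, ?_⟩
  · exact fun v => div_nonneg (abs_nonneg _) hupos.le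
  · exact fun v => (div_le_one hupos).2 (hu v (Finset.mem_univ v))
  · exact div_self hupos.ne'
  · intro v
    have := congrFun hzero v
    rw [hmv, Pi.zero_apply] at this
    rw [← Finset.sum_div, ← mul_div_assoc]
    congr 1
    linarith

/-- A nonzero solution of the eigenvalue equations bounds the spectral radius from below. -/
theorem le_graphSpectralRadius_of_eigenvector {V : Type*} [Fintype V] [DecidableEq V]
    (G : SimpleGraph V) [DecidableRel G.Adj] {r : ℝ} {x : V → ℝ} {v₀ : V} (h0 : x v₀ ≠ 0)
    (heig : ∀ v, r * x v = ∑ w ∈ G.neighborFinset v, x w) : r ≤ graphSpectralRadius G := by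
  have : Nonempty V := ⟨v₀⟩
  obtain ⟨-, -, -, hall⟩ := exists_abs_eq_graphSpectralRadius G
  refine (le_abs_self r).trans (hall r ?_)
  rw [← Matrix.spectrum_toLin', ← Module.End.hasEigenvalue_iff_mem_spectrum]
  refine Module.End.hasEigenvalue_of_hasEigenvector (x := x)
    (Module.End.hasEigenvector_iff.2 ⟨?_, fun h => h0 (congrFun h v₀)⟩)
  rw [Module.End.mem_eigenspace_iff]
  funext v
  rw [Matrix.toLin'_apply, SimpleGraph.adjMatrix_mulVec_apply, ← heig]
  rfl

/-! ### Edge and walk counts around the peak -/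

section Counting

variable {V : Type*} [Fintype V] [DecidableEq V] (G : SimpleGraph V) [DecidableRel G.Adj]

/-- The number of neighbours of `v` in `S`. -/
def degIn (S : Finset V) (v : V) : ℕ := (S.filter (G.Adj v)).card

/-- The vertices that are neither `u` nor adjacent to `u`. -/
def farSet (u : V) : Finset V := (insert u (G.neighborFinset u))ᶜ

variable {G}

theorem mem_farSet {u w : V} : w ∈ farSet G u ↔ w ≠ u ∧ ¬ G.Adj u w := by
  simp [farSet]

theorem sum_eq_peak_add_neighbors_add_far {M : Type*} [AddCommMonoid M] (u : V) (g : V → M) :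
    ∑ v, g v = g u + ∑ v ∈ G.neighborFinset u, g v + ∑ w ∈ farSet G u, g w := by
  rw [farSet, ← Finset.sum_insert (by simp), Finset.sum_add_sum_compl]

theorem sum_neighborFinset_eq (u v : V) {M : Type*} [AddCommMonoid M] (g : V → M) :
    ∑ w ∈ G.neighborFinset v, g w = (if G.Adj v u then g u else 0) +
      ∑ w ∈ (G.neighborFinset u).filter (G.Adj v), g w +
      ∑ w ∈ (farSet G u).filter (G.Adj v), g w := by
  rw [Finset.sum_filter, Finset.sum_filter,
    ← sum_eq_peak_add_neighbors_add_far u (fun w => if G.Adj v w then g w else 0),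
    ← Finset.sum_filter]
  congr 1
  ext w
  simp

theorem sum_sum_filter_adj (S T : Finset V) (g : V → ℝ) :
    ∑ v ∈ S, ∑ w ∈ T.filter (G.Adj v), g w = ∑ w ∈ T, (degIn G S w : ℝ) * g w := by
  simp_rw [Finset.sum_filter]
  rw [Finset.sum_comm]
  refine Finset.sum_congr rfl fun w _ => ?_
  rw [← Finset.sum_filter, Finset.sum_const, nsmul_eq_mul, degIn]
  congr 4
  ext v
  exact G.adj_comm v w

theorem sum_degIn_comm (S T : Finset V) : ∑ v ∈ S, degIn G T v = ∑ w ∈ T, degIn G S w := by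
  have := sum_sum_filter_adj (G := G) S T (fun _ => 1)
  simp only [Finset.sum_const, nsmul_eq_mul, mul_one] at this
  exact_mod_cast this

theorem degree_eq_degIn (u v : V) : G.degree v = (if G.Adj v u then 1 else 0) +
    degIn G (G.neighborFinset u) v + degIn G (farSet G u) v := by
  have := sum_neighborFinset_eq (G := G) u v (fun _ => 1)
  simpa [degIn] using this

/-- Twice the number of edges, counted by the parts `{u}`, `N(u)` and the rest. -/
theorem two_mul_card_edgeFinset_eq (u : V) :
    2 * G.edgeFinset.card = 2 * G.degree u +
      ∑ v ∈ G.neighborFinset u, degIn G (G.neighborFinset u) v +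
      2 * ∑ w ∈ farSet G u, degIn G (G.neighborFinset u) w +
      ∑ w ∈ farSet G u, degIn G (farSet G u) w := by
  rw [← G.sum_degrees_eq_twice_card_edges, sum_eq_peak_add_neighbors_add_far (G := G) u]
  have h1 : ∑ v ∈ G.neighborFinset u, G.degree v = G.degree u +
      ∑ v ∈ G.neighborFinset u, degIn G (G.neighborFinset u) v +
      ∑ w ∈ farSet G u, degIn G (G.neighborFinset u) w := by
    rw [← sum_degIn_comm (G.neighborFinset u) (farSet G u),
      ← G.card_neighborFinset_eq_degree u, Finset.card_eq_sum_ones, ← Finset.sum_add_distrib,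
      ← Finset.sum_add_distrib]
    refine Finset.sum_congr rfl fun v hv => ?_
    rw [degree_eq_degIn u v, if_pos ((G.mem_neighborFinset u v).1 hv).symm]
  have h2 : ∑ w ∈ farSet G u, G.degree w =
      ∑ w ∈ farSet G u, degIn G (G.neighborFinset u) w +
      ∑ w ∈ farSet G u, degIn G (farSet G u) w := by
    rw [← Finset.sum_add_distrib]
    refine Finset.sum_congr rfl fun w hw => ?_
    rw [degree_eq_degIn u w, if_neg (fun h => (mem_farSet.1 hw).2 h.symm), zero_add]
  rw [h1, h2]
  ring

/-- Each edge at `w` inside `S` is counted from both ends. This turns a bound on `e(W)` into one on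
single degrees. -/
theorem two_mul_degIn_le (S : Finset V) {w : V} (hw : w ∈ S) :
    2 * degIn G S w ≤ ∑ v ∈ S, degIn G S v := by
  have h1 : degIn G S w ≤ ∑ v ∈ S.filter (G.Adj w), degIn G S v := by
    rw [degIn, Finset.card_eq_sum_ones]
    refine Finset.sum_le_sum fun v hv => ?_
    rw [Finset.mem_filter] at hv
    exact Finset.card_pos.2 ⟨w, Finset.mem_filter.2 ⟨hw, hv.2.symm⟩⟩
  have h2 : ∑ v ∈ insert w (S.filter (G.Adj w)), degIn G S v ≤ ∑ v ∈ S, degIn G S v := by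
    apply Finset.sum_le_sum_of_subset
    exact Finset.insert_subset hw (Finset.filter_subset _ _)
  rw [Finset.sum_insert (by simp)] at h2
  omega

theorem degIn_pos {S : Finset V} {v w : V} (hw : w ∈ S) (h : G.Adj v w) : 0 < degIn G S v :=
  Finset.card_pos.2 ⟨w, Finset.mem_filter.2 ⟨hw, h⟩⟩

theorem exists_adj_of_degIn_pos {S : Finset V} {v : V} (h : 0 < degIn G S v) :
    ∃ w ∈ S, G.Adj v w := by
  obtain ⟨w, hw⟩ := Finset.card_pos.1 h
  exact ⟨w, (Finset.mem_filter.1 hw).1, (Finset.mem_filter.1 hw).2⟩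

namespace IsPeakEigenvector

variable {r : ℝ} {x : V → ℝ} {u : V}

theorem sum_neighborFinset (hx : IsPeakEigenvector G r x u) :
    ∑ v ∈ G.neighborFinset u, x v = r := by
  rw [← hx.eig, hx.peak, mul_one]

theorem mul_apply_le_degree (hx : IsPeakEigenvector G r x u) (v : V) :
    r * x v ≤ G.degree v := by
  rw [hx.eig, ← G.card_neighborFinset_eq_degree, Finset.card_eq_sum_ones, Nat.cast_sum]
  exact Finset.sum_le_sum fun w _ => by simpa using hx.le_one w

/-- The eigenvalue equation is used twice, starting from `u`: 2-walks returning to `u` contribute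
its degree, and the others are grouped by their endpoint in `N` or `W`. -/
theorem sq_eq (hx : IsPeakEigenvector G r x u) :
    r ^ 2 = G.degree u + ∑ v ∈ G.neighborFinset u, (degIn G (G.neighborFinset u) v : ℝ) * x v +
      ∑ w ∈ farSet G u, (degIn G (G.neighborFinset u) w : ℝ) * x w := by
  rw [sq]
  nth_rewrite 2 [← hx.sum_neighborFinset]
  rw [Finset.mul_sum, ← sum_sum_filter_adj, ← sum_sum_filter_adj,
    ← G.card_neighborFinset_eq_degree u, Finset.card_eq_sum_ones, Nat.cast_sum,
    ← Finset.sum_add_distrib, ← Finset.sum_add_distrib]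
  refine Finset.sum_congr rfl fun v hv => ?_
  rw [hx.eig, sum_neighborFinset_eq u v, if_pos ((G.mem_neighborFinset u v).1 hv).symm, hx.peak,
    Nat.cast_one]

/-- Comparing the walk count at the peak `u` with the number of edges. -/
theorem key_inequality (hx : IsPeakEigenvector G r x u)
    (hgap : (G.edgeFinset.card : ℝ) - 2 < r ^ 2 - r) :
    ((∑ v ∈ G.neighborFinset u, degIn G (G.neighborFinset u) v : ℕ) : ℝ) / 2 +
      ((∑ w ∈ farSet G u, degIn G (farSet G u) w : ℕ) : ℝ) / 2 +
      ∑ w ∈ farSet G u, (degIn G (G.neighborFinset u) w : ℝ) * (1 - x w) + r <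
    2 + ∑ v ∈ G.neighborFinset u, (degIn G (G.neighborFinset u) v : ℝ) * x v := by
  have h1 := hx.sq_eq
  have h2 : (2 : ℝ) * G.edgeFinset.card = 2 * G.degree u +
      ((∑ v ∈ G.neighborFinset u, degIn G (G.neighborFinset u) v : ℕ) : ℝ) +
      2 * ((∑ w ∈ farSet G u, degIn G (G.neighborFinset u) w : ℕ) : ℝ) +
      ((∑ w ∈ farSet G u, degIn G (farSet G u) w : ℕ) : ℝ) := by
    exact_mod_cast two_mul_card_edgeFinset_eq (G := G) u
  have h3 : ∑ w ∈ farSet G u, (degIn G (G.neighborFinset u) w : ℝ) * (1 - x w) =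
      ((∑ w ∈ farSet G u, degIn G (G.neighborFinset u) w : ℕ) : ℝ) -
      ∑ w ∈ farSet G u, (degIn G (G.neighborFinset u) w : ℝ) * x w := by
    rw [Nat.cast_sum, ← Finset.sum_sub_distrib]
    exact Finset.sum_congr rfl fun w _ => by ring
  linarith

theorem sum_degIn_mul_one_sub_nonneg (hx : IsPeakEigenvector G r x u) (S T : Finset V) :
    0 ≤ ∑ w ∈ S, (degIn G T w : ℝ) * (1 - x w) :=
  Finset.sum_nonneg fun w _ => mul_nonneg (Nat.cast_nonneg _) (by linarith [hx.le_one w])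

theorem sum_degIn_mul_le (hx : IsPeakEigenvector G r x u) (S T : Finset V) :
    ∑ w ∈ S, (degIn G T w : ℝ) * x w ≤ ((∑ w ∈ S, degIn G T w : ℕ) : ℝ) := by
  rw [Nat.cast_sum]
  exact Finset.sum_le_sum fun w _ =>
    mul_le_of_le_one_right (Nat.cast_nonneg _) (hx.le_one w)

end IsPeakEigenvector

end Counting

/-! ### The graph induced on the neighbourhood of the peak has a vertex of degree at least four -/

section Neighborhood

variable {V : Type*} [Fintype V] [DecidableEq V] {G : SimpleGraph V} [DecidableRel G.Adj]

theorem degIn_mono {S T : Finset V} (h : S ⊆ T) (v : V) : degIn G S v ≤ degIn G T v :=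
  Finset.card_le_card (Finset.filter_subset_filter _ h)

theorem degIn_le_card_of_forall_mem {S T : Finset V} {v : V}
    (h : ∀ w ∈ S, G.Adj v w → w ∈ T) : degIn G S v ≤ T.card :=
  Finset.card_le_card fun w hw => h w (Finset.mem_filter.1 hw).1 (Finset.mem_filter.1 hw).2

/-- In an `H(4,3)`-free graph no neighbourhood contains a path on three vertices and a disjoint
edge. -/
theorem SimpleGraph.false_of_path_edge_in_neighborhood (hfree : graphH43.Free G)
    {u a b c d e : V} (ha : G.Adj u a) (hb : G.Adj u b) (hc : G.Adj u c) (hd : G.Adj u d)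
    (he : G.Adj u e) (hab : G.Adj a b) (hbc : G.Adj b c) (hac : a ≠ c) (hde : G.Adj d e)
    (hda : d ≠ a) (hdb : d ≠ b) (hdc : d ≠ c) (hea : e ≠ a) (heb : e ≠ b) (hec : e ≠ c) :
    False :=
  not_free_of_cycle_triangle ha hab hbc hc.symm hd hde he.symm hb.ne' hac hda hdb hdc hea heb hec
    hfree

namespace IsPeakEigenvector

variable {r : ℝ} {x : V → ℝ} {u : V}

/-- With `x ≤ 1` on `N` the key inequality gives `r < 2 + e(N)`, so `e(N) > 9/2`. -/
theorem nine_lt_sum_degIn (hx : IsPeakEigenvector G r x u)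
    (hgap : (G.edgeFinset.card : ℝ) - 2 < r ^ 2 - r) (hr : 13 / 2 < r) :
    9 < ∑ v ∈ G.neighborFinset u, degIn G (G.neighborFinset u) v := by
  have h1 := hx.key_inequality hgap
  have h2 := hx.sum_degIn_mul_le (G.neighborFinset u) (G.neighborFinset u)
  have h3 := hx.sum_degIn_mul_one_sub_nonneg (farSet G u) (G.neighborFinset u)
  have h4 : (0 : ℝ) ≤ ((∑ w ∈ farSet G u, degIn G (farSet G u) w : ℕ) : ℝ) := Nat.cast_nonneg _
  have h5 : (9 : ℝ) <
      ((∑ v ∈ G.neighborFinset u, degIn G (G.neighborFinset u) v : ℕ) : ℝ) := by linarith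
  exact_mod_cast h5

/-- Were `G[N]` a matching, the weighted degree sum would be at most `∑_N x = r`, so `r` would
cancel and leave `e(N) < 2`. -/
theorem exists_two_le_degIn (hx : IsPeakEigenvector G r x u)
    (hgap : (G.edgeFinset.card : ℝ) - 2 < r ^ 2 - r) (hr : 13 / 2 < r) :
    ∃ v ∈ G.neighborFinset u, 2 ≤ degIn G (G.neighborFinset u) v := by
  by_contra! hcon
  have h0 := hx.nine_lt_sum_degIn hgap hr
  have h1 := hx.key_inequality hgap
  have h2 : ∑ v ∈ G.neighborFinset u, (degIn G (G.neighborFinset u) v : ℝ) * x v ≤ r := by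
    rw [← hx.sum_neighborFinset]
    refine Finset.sum_le_sum fun v hv => mul_le_of_le_one_left (hx.nonneg v) ?_
    have := hcon v hv
    exact_mod_cast (by omega : degIn G (G.neighborFinset u) v ≤ 1)
  have h3 := hx.sum_degIn_mul_one_sub_nonneg (farSet G u) (G.neighborFinset u)
  have h4 : (0 : ℝ) ≤ ((∑ w ∈ farSet G u, degIn G (farSet G u) w : ℕ) : ℝ) := Nat.cast_nonneg _
  have h5 : (9 : ℝ) <
      ((∑ v ∈ G.neighborFinset u, degIn G (G.neighborFinset u) v : ℕ) : ℝ) := by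
    exact_mod_cast h0
  linarith

/-- With maximum degree 2, every edge of `G[N]` must meet the path `a v b`. The path contributes at
most 6 to the degree sum and the remaining vertices at most 2, which is below the required 9. -/
theorem exists_three_le_degIn (hx : IsPeakEigenvector G r x u) (hfree : graphH43.Free G)
    (hgap : (G.edgeFinset.card : ℝ) - 2 < r ^ 2 - r) (hr : 13 / 2 < r) :
    ∃ v ∈ G.neighborFinset u, 3 ≤ degIn G (G.neighborFinset u) v := by
  by_contra! hcon
  obtain ⟨v, hv, hv2⟩ := hx.exists_two_le_degIn hgap hr
  have h0 := hx.nine_lt_sum_degIn hgap hr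
  set N := G.neighborFinset u with hN
  have hmem : ∀ {y}, y ∈ N ↔ G.Adj u y := by simp [hN]
  have hv3 : degIn G N v = 2 := by have := hcon v hv; omega
  obtain ⟨a, b, hab, hfil⟩ := Finset.card_eq_two.1 hv3
  have hiff : ∀ y, (y ∈ N ∧ G.Adj v y) ↔ (y = a ∨ y = b) := by
    intro y
    rw [← Finset.mem_filter, hfil]
    simp
  obtain ⟨haN, hva⟩ := (hiff a).2 (Or.inl rfl)
  obtain ⟨hbN, hvb⟩ := (hiff b).2 (Or.inr rfl)
  let C : Finset V := {v, a, b}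
  have hCN : C ⊆ N := by
    intro y hy
    simp only [C, Finset.mem_insert, Finset.mem_singleton] at hy
    rcases hy with rfl | rfl | rfl <;> assumption
  have h1 : ∑ y ∈ C, degIn G N y ≤ 6 := by
    calc _ ≤ ∑ y ∈ C, 2 := Finset.sum_le_sum fun y hy => by
            have := hcon y (hCN hy); omega
      _ = C.card * 2 := by simp
      _ ≤ 3 * 2 := Nat.mul_le_mul_right _ Finset.card_le_three
  have h2 : ∑ y ∈ N \ C, degIn G N y ≤ ∑ y ∈ N \ C, degIn G {a, b} y := by
    refine Finset.sum_le_sum fun y hy => Finset.card_le_card fun z hz => ?_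
    simp only [Finset.mem_filter, Finset.mem_insert, Finset.mem_singleton] at hz ⊢
    refine ⟨?_, hz.2⟩
    rw [Finset.mem_sdiff] at hy
    simp only [C, Finset.mem_insert, Finset.mem_singleton, not_or] at hy
    obtain ⟨hyN, hyv, hya, hyb⟩ := hy
    by_contra! hzab
    have hzv : z ≠ v := by
      rintro rfl
      rcases (hiff y).1 ⟨hyN, hz.2.symm⟩ with h | h
      · exact hya h
      · exact hyb h
    exact SimpleGraph.false_of_path_edge_in_neighborhood hfree (hmem.1 haN) (hmem.1 hv)
      (hmem.1 hbN) (hmem.1 hyN) (hmem.1 hz.1) hva.symm hvb hab hz.2 hya hyv hyb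
      hzab.1 hzv hzab.2
  have h3 : ∀ c ∈ ({a, b} : Finset V), degIn G (N \ C) c ≤ 1 := by
    intro c hc
    have hcN : c ∈ N ∧ G.Adj v c := (hiff c).2 (by simpa using hc)
    have hlt : degIn G (N \ C) c < degIn G N c := by
      refine Finset.card_lt_card ⟨Finset.filter_subset_filter _ Finset.sdiff_subset, fun h => ?_⟩
      have := h (Finset.mem_filter.2 ⟨hv, hcN.2.symm⟩)
      simp [C] at this
    have := hcon c hcN.1
    omega
  have h4 : ∑ y ∈ N \ C, degIn G {a, b} y ≤ 2 := by
    rw [sum_degIn_comm]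
    calc _ ≤ ∑ y ∈ ({a, b} : Finset V), 1 := Finset.sum_le_sum h3
      _ = ({a, b} : Finset V).card := by simp
      _ ≤ 2 := Finset.card_le_two
  have h5 := Finset.sum_sdiff (f := fun y => degIn G N y) hCN
  omega

/-- The neighbourhood of the peak has no nontrivial component on four vertices that contains
`K₄` minus an edge. -/
theorem false_of_diamond (hx : IsPeakEigenvector G r x u) (hfree : graphH43.Free G)
    (hgap : (G.edgeFinset.card : ℝ) - 2 < r ^ 2 - r) (hr : 13 / 2 < r) {v a b c : V}
    (hv : G.Adj u v) (ha : G.Adj u a) (hb : G.Adj u b) (hc : G.Adj u c)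
    (hva : G.Adj v a) (hvb : G.Adj v b) (hvc : G.Adj v c) (hab : G.Adj a b) (hac : G.Adj a c)
    (hbc : b ≠ c)
    (hC : ∀ y z, G.Adj u y → G.Adj u z → G.Adj y z → y = v ∨ y = a ∨ y = b ∨ y = c) :
    False := by
  have h0 := hx.nine_lt_sum_degIn hgap hr
  have hkey := hx.key_inequality hgap
  set N := G.neighborFinset u with hN
  set W := farSet G u with hW
  have hmem : ∀ {y}, y ∈ N ↔ G.Adj u y := by simp [hN]
  set C : Finset V := {v, a, b, c} with hCdef
  have hCmem : ∀ {y}, y ∈ C ↔ y = v ∨ y = a ∨ y = b ∨ y = c := by simp [hCdef]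
  have hCN : C ⊆ N := by
    intro y hy
    rcases hCmem.1 hy with rfl | rfl | rfl | rfl <;> exact hmem.2 ‹_›
  have hcard : C.card = 4 := by
    have h1 := hva.ne
    have h2 := hvb.ne
    have h3 := hvc.ne
    have h4 := hab.ne
    have h5 := hac.ne
    rw [hCdef]
    grind
  have hout : ∀ y ∈ N, y ∉ C → degIn G N y = 0 := by
    intro y hy hyC
    by_contra h
    obtain ⟨z, hz, hyz⟩ := exists_adj_of_degIn_pos (Nat.pos_of_ne_zero h)
    exact hyC (hCmem.2 (hC y z (hmem.1 hy) (hmem.1 hz) hyz))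
  have hin : ∀ y ∈ C, degIn G N y ≤ 3 := by
    intro y hy
    have : degIn G N y ≤ (C.erase y).card := degIn_le_card_of_forall_mem fun z hz hyz =>
      Finset.mem_erase.2 ⟨hyz.ne', hCmem.2 (hC z y (hmem.1 hz) (hmem.1 (hCN hy)) hyz.symm)⟩
    rw [Finset.card_erase_of_mem hy, hcard] at this
    exact this
  have hM : ∑ y ∈ N, degIn G N y ≤ 12 := by
    rw [← Finset.sum_subset hCN hout]
    calc _ ≤ ∑ y ∈ C, 3 := Finset.sum_le_sum hin
      _ = 12 := by simp [hcard]
  set s := ∑ y ∈ C, x y with hs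
  have hMx : ∑ y ∈ N, (degIn G N y : ℝ) * x y ≤ 3 * s := by
    rw [← Finset.sum_subset hCN fun y hy hyC => by rw [hout y hy hyC]; simp, hs, Finset.mul_sum]
    refine Finset.sum_le_sum fun y hy => mul_le_mul_of_nonneg_right ?_ (hx.nonneg y)
    exact_mod_cast hin y hy
  have hMx' := hx.sum_degIn_mul_le N N
  have hS0 := hx.sum_degIn_mul_one_sub_nonneg W N
  have hMr : ((∑ y ∈ N, degIn G N y : ℕ) : ℝ) ≤ 12 := by exact_mod_cast hM
  have hMl : (9 : ℝ) < ((∑ y ∈ N, degIn G N y : ℕ) : ℝ) := by exact_mod_cast h0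
  have hK0 : (0 : ℝ) ≤ ((∑ w ∈ W, degIn G W w : ℕ) : ℝ) := Nat.cast_nonneg _
  have hs3 : 3 < s := by linarith
  have hS : ∑ w ∈ W, (degIn G N w : ℝ) * (1 - x w) < 3 / 2 := by linarith
  have hK : ∑ w ∈ W, degIn G W w < 3 := by
    have : ((∑ w ∈ W, degIn G W w : ℕ) : ℝ) < 3 := by linarith
    exact_mod_cast this
  -- Two neighbours `p, q` of `w` give the 4-cycle `u p w q`; an edge of the diamond avoiding both
  -- closes a triangle at `u`. Only `{p, q} = {v, a}` meets every edge used; then the 4-cycle `v b u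
  -- c` and the triangle `v a w` share `v`.
  have huniq : ∀ w ∈ W, ∀ p ∈ C, ∀ q ∈ N, G.Adj w p → G.Adj w q → q = p := by
    intro w hw p hp q hq hwp hwq
    by_contra hqp
    have hwu := (mem_farSet.1 hw).1
    have hwN := (mem_farSet.1 hw).2
    have hup := hmem.1 (hCN hp)
    have huq := hmem.1 hq
    have hH : ∀ d e, G.Adj u d → G.Adj u e → G.Adj d e → d ≠ p → d ≠ q → e ≠ p → e ≠ q →
        False := fun d e hd he hde h1 h2 h3 h4 =>
      not_free_of_cycle_triangle hup hwp.symm hwq huq.symm hd hde he.symm hwu (Ne.symm hqp)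
        h1 (fun h => hwN (h ▸ hd)) h2 h3 (fun h => hwN (h ▸ he)) h4 hfree
    have hwb : w ≠ b := fun h => hwN (h ▸ hb)
    have hwc : w ≠ c := fun h => hwN (h ▸ hc)
    have hsp : G.Adj w v → G.Adj w a → False := fun h1 h2 =>
      not_free_of_cycle_triangle hvb hb.symm hc hvc.symm hva h2.symm h1 hv.ne hbc hab.ne
        ha.ne' hac.ne hwb hwu hwc hfree
    have e1 := hva.ne
    have e2 := hvb.ne
    have e3 := hvc.ne
    have e4 := hab.ne
    have e5 := hac.ne
    have k1 := hH a b ha hb hab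
    have k2 := hH a c ha hc hac
    have k3 := hH v b hv hb hvb
    have k4 := hH v c hv hc hvc
    have k5 := hH v a hv ha hva
    rcases hCmem.1 hp with rfl | rfl | rfl | rfl <;> grind
  -- A vertex `w` attached to `C` has degree at most 2, so `x w ≤ 2/r < 4/13` and `x w / (1 - x w) ≤
  -- 4/9`.
  have hterm : ∀ w ∈ W, (degIn G C w : ℝ) * x w ≤ 4 / 9 * ((degIn G N w : ℝ) * (1 - x w)) := by
    intro w hw
    have hx1 := hx.le_one w
    rcases Nat.eq_zero_or_pos (degIn G C w) with h | h
    · rw [h]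
      have : (0 : ℝ) ≤ (degIn G N w : ℝ) * (1 - x w) :=
        mul_nonneg (Nat.cast_nonneg _) (by linarith)
      push_cast
      linarith
    · obtain ⟨p, hp, hwp⟩ := exists_adj_of_degIn_pos h
      have h1 : degIn G N w ≤ ({p} : Finset V).card := degIn_le_card_of_forall_mem
        fun q hq hwq => Finset.mem_singleton.2 (huniq w hw p hp q hq hwp hwq)
      rw [Finset.card_singleton] at h1
      have h2 := degIn_mono (G := G) hCN w
      have h3 := two_mul_degIn_le (G := G) W hw
      have h4 := degree_eq_degIn (G := G) u w
      rw [if_neg (fun h => (mem_farSet.1 hw).2 h.symm), ← hN, ← hW] at h4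
      have h5 : G.degree w ≤ 2 := by omega
      have h6 := hx.mul_apply_le_degree w
      have h7 : (G.degree w : ℝ) ≤ 2 := by exact_mod_cast h5
      have h8 : x w ≤ 4 / 13 := by nlinarith [hx.nonneg w]
      rw [show degIn G C w = 1 by omega, show degIn G N w = 1 by omega]
      push_cast
      linarith
  have hT : ∑ w ∈ W, (degIn G C w : ℝ) * x w ≤ 2 / 3 := by
    have := Finset.sum_le_sum hterm
    rw [← Finset.mul_sum] at this
    linarith
  have hNC : ∑ y ∈ N, (degIn G C y : ℝ) * x y ≤ 3 * s := by
    refine le_trans (Finset.sum_le_sum fun y hy => ?_) hMx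
    refine mul_le_mul_of_nonneg_right ?_ (hx.nonneg y)
    exact_mod_cast degIn_mono hCN y
  -- The eigenvalue equations summed over `C` give `r s ≤ 4 + 3 s + 2/3`, incompatible with `r >
  -- 13/2` and `s > 3`.
  have hrs : r * s = 4 + ∑ y ∈ N, (degIn G C y : ℝ) * x y +
      ∑ w ∈ W, (degIn G C w : ℝ) * x w := by
    rw [hs, Finset.mul_sum, ← sum_sum_filter_adj, ← sum_sum_filter_adj,
      show (4 : ℝ) = ∑ y ∈ C, 1 by simp [hcard], ← Finset.sum_add_distrib,
      ← Finset.sum_add_distrib]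
    refine Finset.sum_congr rfl fun y hy => ?_
    rw [hx.eig, sum_neighborFinset_eq u y, if_pos (hmem.1 (hCN hy)).symm, hx.peak]
  nlinarith

/-- With maximum degree 3 all edges of `G[N]` lie on `v` and its three neighbours there. If at most
one pair of these neighbours is adjacent, the degree sum is at most 8; otherwise there is a diamond.
-/
theorem exists_four_le_degIn (hx : IsPeakEigenvector G r x u) (hfree : graphH43.Free G)
    (hgap : (G.edgeFinset.card : ℝ) - 2 < r ^ 2 - r) (hr : 13 / 2 < r) :
    ∃ v ∈ G.neighborFinset u, 4 ≤ degIn G (G.neighborFinset u) v := by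
  by_contra! hcon
  obtain ⟨v, hv, hv2⟩ := hx.exists_three_le_degIn hfree hgap hr
  have h0 := hx.nine_lt_sum_degIn hgap hr
  have hv3 : degIn G (G.neighborFinset u) v = 3 := by have := hcon v hv; omega
  obtain ⟨a, b, c, hab, hac, hbc, hfil⟩ := Finset.card_eq_three.1 hv3
  have hiff : ∀ y, (G.Adj u y ∧ G.Adj v y) ↔ (y = a ∨ y = b ∨ y = c) := by
    intro y
    rw [← G.mem_neighborFinset, ← Finset.mem_filter, hfil]
    simp
  obtain ⟨ha, hva⟩ := (hiff a).2 (by simp)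
  obtain ⟨hb, hvb⟩ := (hiff b).2 (by simp)
  obtain ⟨hc, hvc⟩ := (hiff c).2 (by simp)
  have hv' : G.Adj u v := (G.mem_neighborFinset u v).1 hv
  -- An edge `yz` with `y` outside meets at most one of `a, b, c`; the other two form with `v` a
  -- path disjoint from it.
  have hC : ∀ y z, G.Adj u y → G.Adj u z → G.Adj y z → y = v ∨ y = a ∨ y = b ∨ y = c := by
    intro y z hy hz hyz
    by_contra! h
    obtain ⟨hyv, hya, hyb, hyc⟩ := h
    have hzv : z ≠ v := by
      rintro rfl
      have := (hiff y).1 ⟨hy, hyz.symm⟩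
      tauto
    have key : ∀ p q, G.Adj u p → G.Adj u q → G.Adj v p → G.Adj v q → p ≠ q → y ≠ p → y ≠ q →
        z ≠ p → z ≠ q → False := fun p q hp hq hvp hvq hpq h1 h2 h3 h4 =>
      SimpleGraph.false_of_path_edge_in_neighborhood hfree hp hv' hq hy hz hvp.symm hvq hpq hyz
        h1 hyv h2 h3 hzv h4
    by_cases hza : z = a
    · subst hza
      exact key b c hb hc hvb hvc hbc hyb hyc hab hac
    by_cases hzb : z = b
    · subst hzb
      exact key a c ha hc hva hvc hac hya hyc hza hbc
    · exact key a b ha hb hva hvb hab hya hyb hza hzb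
  have few : ∀ a b c : V, a ≠ b → a ≠ c → b ≠ c → G.Adj u a → G.Adj u b → G.Adj u c →
      G.Adj v a → G.Adj v b → G.Adj v c →
      (∀ y z, G.Adj u y → G.Adj u z → G.Adj y z → y = v ∨ y = a ∨ y = b ∨ y = c) →
      ¬ G.Adj a b → ¬ G.Adj a c → False := by
    intro a b c hab hac hbc ha hb hc hva hvb hvc hC nab nac
    have hsub : ({v, a, b, c} : Finset V) ⊆ G.neighborFinset u := by
      intro y hy
      simp only [Finset.mem_insert, Finset.mem_singleton] at hy
      rcases hy with rfl | rfl | rfl | rfl <;> simpa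
    rw [← Finset.sum_subset hsub, Finset.sum_insert, Finset.sum_insert, Finset.sum_insert,
      Finset.sum_singleton] at h0
    · have h1 : degIn G (G.neighborFinset u) a ≤ ({v} : Finset V).card := by
        refine degIn_le_card_of_forall_mem fun z hz haz => ?_
        rw [G.mem_neighborFinset] at hz
        have e := haz.ne
        have := hC z a hz ha haz.symm
        rw [Finset.mem_singleton]
        grind
      have h2 : degIn G (G.neighborFinset u) b ≤ ({v, c} : Finset V).card := by
        refine degIn_le_card_of_forall_mem fun z hz hbz => ?_
        rw [G.mem_neighborFinset] at hz
        have e := hbz.ne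
        have := hC z b hz hb hbz.symm
        have := hbz.symm
        rw [Finset.mem_insert, Finset.mem_singleton]
        grind
      have h3 : degIn G (G.neighborFinset u) c ≤ ({v, b} : Finset V).card := by
        refine degIn_le_card_of_forall_mem fun z hz hcz => ?_
        rw [G.mem_neighborFinset] at hz
        have e := hcz.ne
        have := hC z c hz hc hcz.symm
        have := hcz.symm
        rw [Finset.mem_insert, Finset.mem_singleton]
        grind
      rw [Finset.card_singleton] at h1
      have h4 : ({v, b} : Finset V).card ≤ 2 := Finset.card_le_two
      have h5 : ({v, c} : Finset V).card ≤ 2 := Finset.card_le_two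
      omega
    · simpa using hbc
    · simp [hab, hac]
    · simp [hva.ne, hvb.ne, hvc.ne]
    · intro y hy hyC
      by_contra h
      obtain ⟨z, hz, hyz⟩ := exists_adj_of_degIn_pos (Nat.pos_of_ne_zero h)
      rw [G.mem_neighborFinset] at hy hz
      exact hyC (by simpa using hC y z hy hz hyz)
  by_cases h1 : G.Adj a b
  · by_cases h2 : G.Adj a c
    · exact hx.false_of_diamond hfree hgap hr hv' ha hb hc hva hvb hvc h1 h2 hbc hC
    · by_cases h3 : G.Adj b c
      · exact hx.false_of_diamond hfree hgap hr hv' hb ha hc hvb hva hvc h1.symm h3 hac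
          fun y z hy hz hyz => by have := hC y z hy hz hyz; tauto
      · exact few c a b hac.symm hbc.symm hab hc ha hb hvc hva hvb
          (fun y z hy hz hyz => by have := hC y z hy hz hyz; tauto)
          (fun h => h2 h.symm) (fun h => h3 h.symm)
  · by_cases h2 : G.Adj a c
    · by_cases h3 : G.Adj b c
      · exact hx.false_of_diamond hfree hgap hr hv' hc ha hb hvc hva hvb h2.symm h3.symm hab
          fun y z hy hz hyz => by have := hC y z hy hz hyz; tauto
      · exact few b a c hab.symm hbc hac hb ha hc hvb hva hvc
          (fun y z hy hz hyz => by have := hC y z hy hz hyz; tauto)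
          (fun h => h1 h.symm) h3
    · exact few a b c hab hac hbc ha hb hc hva hvb hvc hC h1 h2

end IsPeakEigenvector

end Neighborhood

/-! ### The neighbourhood is a star with isolated vertices -/

section Star

variable {V : Type*} [Fintype V] [DecidableEq V] {G : SimpleGraph V} [DecidableRel G.Adj]

/-- The polynomial whose largest root is `rhoPrime`. -/
noncomputable def rhoPrimePoly (m t : ℝ) : ℝ := t ^ 4 - m * t ^ 2 - (m - 2) * t + m / 2 - 1

/-- All vertices are adjacent to both `p` and `q`, except for `z`, which is adjacent to `p` only;
there are no further edges. -/
structure IsBookWithPendant (G : SimpleGraph V) (p q z : V) : Prop where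
  adj_left : ∀ y, y ≠ p → G.Adj p y
  adj_right : ∀ y, y ≠ q → y ≠ z → G.Adj q y
  not_adj : ¬ G.Adj q z
  ne : z ≠ q
  cover : ∀ a b, G.Adj a b → a = p ∨ a = q ∨ b = p ∨ b = q

namespace IsPeakEigenvector

variable {r : ℝ} {x : V → ℝ} {u : V}

set_option maxHeartbeats 1000000 in
/-- If some neighbour of the peak has four common neighbours with it, then the graph is the
extremal one, or `rhoPrimePoly` is negative at the eigenvalue. -/
theorem isBookWithPendant_or_of_four_le (hx : IsPeakEigenvector G r x u)
    (hfree : graphH43.Free G) (hgap : (G.edgeFinset.card : ℝ) - 2 < r ^ 2 - r)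
    (hr : 13 / 2 < r) (heven : Even G.edgeFinset.card) (hiso : ∀ v, ∃ w, G.Adj v w) {v : V}
    (hv : G.Adj u v) (h4 : 4 ≤ degIn G (G.neighborFinset u) v) :
    (∃ p q z, IsBookWithPendant G p q z) ∨ rhoPrimePoly G.edgeFinset.card r < 0 := by
  have hkey := hx.key_inequality hgap
  have hedges := two_mul_card_edgeFinset_eq (G := G) u
  have hnbr := fun y => hx.eig y ▸ sum_neighborFinset_eq (G := G) u y x
  have hsumN := hx.sum_neighborFinset
  have hdegu := G.card_neighborFinset_eq_degree u
  set N := G.neighborFinset u with hN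
  set W := farSet G u with hW
  have hmem : ∀ {y}, y ∈ N ↔ G.Adj u y := by simp [hN]
  set L := N.filter (G.Adj v) with hL
  set I := N.filter (fun y => y ≠ v ∧ ¬ G.Adj v y) with hI
  have hLmem : ∀ {y}, y ∈ L ↔ G.Adj u y ∧ G.Adj v y := by simp [hL, hmem]
  have hImem : ∀ {y}, y ∈ I ↔ G.Adj u y ∧ y ≠ v ∧ ¬ G.Adj v y := by simp [hI, hmem]
  have hl4 : 4 ≤ L.card := h4
  -- This is where degree four is needed: two leaves survive after any two vertices are excluded.
  have hpick : ∀ y z, ∃ p q, p ≠ q ∧ (G.Adj u p ∧ G.Adj v p) ∧ (G.Adj u q ∧ G.Adj v q) ∧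
      p ≠ y ∧ p ≠ z ∧ q ≠ y ∧ q ≠ z := by
    intro y z
    have h1 : 1 < (L \ {y, z}).card := by
      have := Finset.le_card_sdiff {y, z} L
      have : ({y, z} : Finset V).card ≤ 2 := Finset.card_le_two
      omega
    obtain ⟨p, hp, q, hq, hpq⟩ := Finset.one_lt_card.1 h1
    simp only [Finset.mem_sdiff, Finset.mem_insert, Finset.mem_singleton, not_or, hLmem] at hp hq
    exact ⟨p, q, hpq, hp.1, hq.1, hp.2.1, hp.2.2, hq.2.1, hq.2.2⟩
  have hstar : ∀ y z, G.Adj u y → G.Adj u z → G.Adj y z → y = v ∨ z = v := by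
    intro y z hy hz hyz
    by_contra! h
    obtain ⟨p, q, hpq, hp, hq, hpy, hpz, hqy, hqz⟩ := hpick y z
    exact SimpleGraph.false_of_path_edge_in_neighborhood hfree hp.1 hv hq.1 hy hz hp.2.symm hq.2
      hpq hyz hpy.symm h.1 hqy.symm hpz.symm h.2 hqz.symm
  have hsplit : ∀ {M : Type} [AddCommMonoid M] (g : V → M),
      ∑ y ∈ N, g y = g v + ∑ y ∈ L, g y + ∑ y ∈ I, g y := by
    intro M _ g
    have h1 : N.filter (fun y => ¬ G.Adj v y) = insert v I := by
      ext y
      simp only [Finset.mem_filter, Finset.mem_insert, hImem, hmem]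
      constructor
      · tauto
      · rintro (rfl | h)
        · exact ⟨hv, G.irrefl⟩
        · exact ⟨h.1, h.2.2⟩
    have hvI : v ∉ I := fun h => (hImem.1 h).2.1 rfl
    rw [← Finset.sum_filter_add_sum_filter_not N (G.Adj v), h1, Finset.sum_insert hvI, ← hL]
    abel
  have hfilL : ∀ y ∈ L, N.filter (G.Adj y) = {v} := by
    intro y hy
    rw [hLmem] at hy
    ext z
    simp only [Finset.mem_filter, Finset.mem_singleton, hmem]
    constructor
    · rintro ⟨hz, hyz⟩
      exact (hstar y z hy.1 hz hyz).resolve_left hy.2.ne'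
    · rintro rfl
      exact ⟨hv, hy.2.symm⟩
  have hfilI : ∀ y ∈ I, N.filter (G.Adj y) = ∅ := by
    intro y hy
    rw [hImem] at hy
    ext z
    simp only [Finset.mem_filter, Finset.notMem_empty, hmem, iff_false, not_and]
    intro hz hyz
    have := (hstar y z hy.1 hz hyz).resolve_left hy.2.1
    subst this
    exact hy.2.2 hyz.symm
  have hdv : degIn G N v = L.card := rfl
  have hdL : ∀ y ∈ L, degIn G N y = 1 := fun y hy => by rw [degIn, hfilL y hy]; simp
  have hdI : ∀ y ∈ I, degIn G N y = 0 := fun y hy => by rw [degIn, hfilI y hy]; simp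
  have hM : ∑ y ∈ N, degIn G N y = 2 * L.card := by
    rw [hsplit, hdv, Finset.sum_congr rfl hdL, Finset.sum_congr rfl hdI]
    simp
    ring
  have hMx : ∑ y ∈ N, (degIn G N y : ℝ) * x y = L.card * x v + ∑ y ∈ L, x y := by
    rw [hsplit, hdv, Finset.sum_congr rfl fun y hy => by rw [hdL y hy],
      Finset.sum_congr (s₁ := I) rfl fun y hy => by rw [hdI y hy]]
    simp
  have hcardN : N.card = 1 + L.card + I.card := by
    simpa using hsplit (fun _ => (1 : ℕ))
  rw [hsplit] at hsumN
  rw [hM, hMx] at hkey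
  rw [hM, ← hdegu, hcardN] at hedges
  have hxv1 := hx.le_one v
  have hS0 := hx.sum_degIn_mul_one_sub_nonneg W N
  have hI0 : 0 ≤ ∑ y ∈ I, x y := Finset.sum_nonneg fun y _ => hx.nonneg y
  have hl4r : (4 : ℝ) ≤ L.card := by exact_mod_cast hl4
  have hlv : 0 ≤ ((L.card : ℝ) - 1) * (1 - x v) :=
    mul_nonneg (by linarith) (by linarith)
  have hK0 : (0 : ℝ) ≤ ((∑ w ∈ W, degIn G W w : ℕ) : ℝ) := Nat.cast_nonneg _
  -- Substituting `r = x v + ∑_L x + ∑_I x` cancels the leaves and leaves the bound `1 - (|L| - 1)(1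
  -- - x v)`.
  have hdef : ((∑ w ∈ W, degIn G W w : ℕ) : ℝ) / 2 +
      ∑ w ∈ W, (degIn G N w : ℝ) * (1 - x w) + ∑ y ∈ I, x y < 1 := by
    push_cast at hkey ⊢
    nlinarith
  have hK : ∑ w ∈ W, degIn G W w < 2 := by
    have : ((∑ w ∈ W, degIn G W w : ℕ) : ℝ) < 2 := by linarith
    exact_mod_cast this
  have hWW : ∀ w ∈ W, degIn G W w = 0 := fun w hw => by
    have := two_mul_degIn_le (G := G) W hw
    omega
  have hWfil : ∀ w ∈ W, W.filter (G.Adj w) = ∅ := fun w hw => Finset.card_eq_zero.1 (hWW w hw)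
  have hWx : ∀ w ∈ W, r * x w = ∑ y ∈ N.filter (G.Adj w), x y := by
    intro w hw
    rw [hnbr w, if_neg (fun h => (mem_farSet.1 hw).2 h.symm), hWfil w hw]
    simp
  have huniq : ∀ w ∈ W, ∀ y ∈ L, ∀ q ∈ N, G.Adj w y → G.Adj w q → q = y := by
    intro w hw y hy q hq hwy hwq
    by_contra hqy
    have hwu := (mem_farSet.1 hw).1
    have hwN := (mem_farSet.1 hw).2
    rw [hLmem] at hy
    rw [hmem] at hq
    by_cases hqv : q = v
    · subst hqv
      obtain ⟨c, d, hcd, hc, hd, hcy, -, hdy, -⟩ := hpick y y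
      exact not_free_of_cycle_triangle hc.2 hc.1.symm hd.1 hd.2.symm hy.2 hwy.symm hwq hv.ne hcd
        hcy.symm hy.1.ne' hdy.symm (fun h => hwN (h ▸ hc.1)) hwu (fun h => hwN (h ▸ hd.1)) hfree
    · obtain ⟨c, -, -, hc, -, hcy, hcq, -, -⟩ := hpick y q
      exact not_free_of_cycle_triangle hy.1 hwy.symm hwq hq.symm hv hc.2 hc.1.symm hwu
        (Ne.symm hqy) hy.2.ne (fun h => hwN (h ▸ hv)) (Ne.symm hqv) hcy
        (fun h => hwN (h ▸ hc.1)) hcq hfree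
  have hx2 : ∀ w ∈ W, r * x w ≤ 2 := by
    intro w hw
    rw [hWx w hw]
    by_cases h : ∃ y ∈ L, G.Adj w y
    · obtain ⟨y, hy, hwy⟩ := h
      have hsub : N.filter (G.Adj w) ⊆ {y} := by
        intro q hq
        rw [Finset.mem_filter] at hq
        exact Finset.mem_singleton.2 (huniq w hw y hy q hq.1 hwy hq.2)
      have := Finset.sum_le_sum_of_subset_of_nonneg hsub (f := x) fun i _ _ => hx.nonneg i
      rw [Finset.sum_singleton] at this
      linarith [hx.le_one y]
    · push Not at h
      have hsub : N.filter (G.Adj w) ⊆ insert v I := by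
        intro q hq
        rw [Finset.mem_filter, hmem] at hq
        rw [Finset.mem_insert, hImem]
        by_cases hqv : q = v
        · exact Or.inl hqv
        · exact Or.inr ⟨hq.1, hqv, fun hvq => h q (hLmem.2 ⟨hq.1, hvq⟩) hq.2⟩
      have := Finset.sum_le_sum_of_subset_of_nonneg hsub (f := x) fun i _ _ => hx.nonneg i
      rw [Finset.sum_insert fun h => (hImem.1 h).2.1 rfl] at this
      linarith
  -- Since `x w ≤ 2/r < 4/13`, each edge between `N` and `W` costs at least `9/13` of a defect below
  -- 1.
  have hE : ∑ w ∈ W, degIn G N w < 2 := by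
    have h1 : 9 / 13 * ((∑ w ∈ W, degIn G N w : ℕ) : ℝ) ≤
        ∑ w ∈ W, (degIn G N w : ℝ) * (1 - x w) := by
      rw [Nat.cast_sum, Finset.mul_sum]
      refine Finset.sum_le_sum fun w hw => ?_
      rw [mul_comm]
      refine mul_le_mul_of_nonneg_left ?_ (Nat.cast_nonneg _)
      nlinarith [hx2 w hw, hx.nonneg w]
    have : ((∑ w ∈ W, degIn G N w : ℕ) : ℝ) < 2 := by linarith
    exact_mod_cast this
  have hWpos : ∀ w ∈ W, 1 ≤ degIn G N w := by
    intro w hw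
    obtain ⟨y, hy⟩ := hiso w
    refine degIn_pos (w := y) ?_ hy
    rw [hmem]
    by_contra hyN
    have hyW : y ∈ W := mem_farSet.2 ⟨fun h => (mem_farSet.1 hw).2 (h ▸ hy).symm, hyN⟩
    have := degIn_pos hyW hy
    rw [hWW w hw] at this
    exact absurd this (lt_irrefl 0)
  have hWcard : W.card ≤ ∑ w ∈ W, degIn G N w := by
    rw [Finset.card_eq_sum_ones]
    exact Finset.sum_le_sum hWpos
  have hvx : r * x v = 1 + ∑ y ∈ L, x y + ∑ w ∈ W.filter (G.Adj v), x w := by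
    rw [hnbr v, if_pos hv.symm, hx.peak]
  have hLx : ∀ y ∈ L, r * x y = 1 + x v + ∑ w ∈ W.filter (G.Adj y), x w := by
    intro y hy
    rw [hnbr y, if_pos (hLmem.1 hy).1.symm, hx.peak, hfilL y hy, Finset.sum_singleton]
  have hIx : ∀ y ∈ I, r * x y = 1 + ∑ w ∈ W.filter (G.Adj y), x w := by
    intro y hy
    rw [hnbr y, if_pos (hImem.1 hy).1.symm, hx.peak, hfilI y hy, Finset.sum_empty, add_zero]
  have hcases : ∀ y, y = u ∨ y ∈ N ∨ y ∈ W := by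
    intro y
    rw [hmem, mem_farSet]
    tauto
  rcases Nat.eq_zero_or_pos W.card with hW0 | hW1
  · rw [Finset.card_eq_zero] at hW0
    simp only [hW0, Finset.filter_empty, Finset.sum_empty, add_zero, Finset.notMem_empty,
      or_false, mul_zero] at hvx hLx hIx hedges hcases
    -- Here `m = 2|L| + |I| + 1`, so even size forces `|I|` odd; `|I| = 1` is the extremal graph.
    have hpodd : Odd I.card := by
      rw [← Nat.not_even_iff_odd]
      rintro ⟨a, ha⟩
      obtain ⟨b, hb⟩ := heven
      omega
    obtain ⟨j, hj⟩ := hpodd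
    have hm : G.edgeFinset.card = 2 * L.card + 2 * j + 2 := by omega
    rcases Nat.eq_zero_or_pos j with rfl | hj0
    · left
      obtain ⟨z, hz⟩ := Finset.card_eq_one.1 hj
      have hzI : z ∈ I := hz ▸ Finset.mem_singleton_self z
      rw [hImem] at hzI
      refine ⟨u, v, z, ?_, ?_, hzI.2.2, hzI.2.1, ?_⟩
      · exact fun y hy => hmem.1 ((hcases y).resolve_left hy)
      · intro y hyv hyz
        rcases hcases y with rfl | hy
        · exact hv.symm
        · by_contra hvy
          have : y ∈ I := hImem.2 ⟨hmem.1 hy, hyv, hvy⟩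
          rw [hz, Finset.mem_singleton] at this
          exact hyz this
      · intro a b hab
        rcases hcases a with ha | ha
        · exact Or.inl ha
        · rcases hcases b with hb | hb
          · exact Or.inr (Or.inr (Or.inl hb))
          · exact (hstar a b (hmem.1 ha) (hmem.1 hb) hab).elim (fun h => Or.inr (Or.inl h))
              fun h => Or.inr (Or.inr (Or.inr h))
    · right
      have e1 : r * ∑ y ∈ L, x y = L.card * (1 + x v) := by
        rw [Finset.mul_sum, Finset.sum_congr rfl hLx, Finset.sum_const, nsmul_eq_mul]
      have e2 : r * ∑ y ∈ I, x y = 2 * j + 1 := by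
        rw [Finset.mul_sum, Finset.sum_congr rfl hIx, Finset.sum_const, nsmul_eq_mul, hj]
        push_cast
        ring
      have hj1 : (1 : ℝ) ≤ j := by exact_mod_cast hj0
      rw [hm, rhoPrimePoly]
      push_cast
      set l : ℝ := (L.card : ℝ)
      set t : ℝ := (j : ℝ)
      have e3 : (r ^ 2 - l - (2 * t + 1)) = (r + l) * x v := by
        have : r * r = r * (x v + ∑ y ∈ L, x y + ∑ y ∈ I, x y) := by rw [hsumN]
        linarith
      have e4 : (r ^ 2 - l) * x v = r + l := by
        have : r * (r * x v) = r * (1 + ∑ y ∈ L, x y) := by rw [hvx]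
        linarith
      -- Modulo this characteristic equation the quartic equals `-t (2 r + 2 l - 1)`.
      have e5 : (r ^ 2 - l) * (r ^ 2 - l - (2 * t + 1)) = (r + l) ^ 2 := by
        rw [e3, mul_left_comm, e4]
        ring
      have e6 : 0 < t * (2 * r + 2 * l - 1) := mul_pos (by linarith) (by linarith)
      nlinarith
  · have hW1' : W.card = 1 := by omega
    obtain ⟨w, hw⟩ := Finset.card_eq_one.1 hW1'
    have hwW : w ∈ W := hw ▸ Finset.mem_singleton_self w
    have hEw : ∑ w ∈ W, degIn G N w = 1 := by omega
    have hdw : degIn G N w = 1 := by rw [hw, Finset.sum_singleton] at hEw; exact hEw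
    have hK' : ∑ w ∈ W, degIn G W w = 0 := Finset.sum_eq_zero hWW
    obtain ⟨q, hq⟩ := Finset.card_eq_one.1 hdw
    have hqm : q ∈ N ∧ G.Adj w q := by
      rw [← Finset.mem_filter, hq]
      exact Finset.mem_singleton_self q
    have hwq : ∀ y ∈ N, G.Adj w y → y = q := by
      intro y hy hwy
      rw [← Finset.mem_singleton, ← hq]
      exact Finset.mem_filter.2 ⟨hy, hwy⟩
    have hxw := hWx w hwW
    rw [hq, Finset.sum_singleton] at hxw
    have hIw : ∑ y ∈ I, x y < x w := by
      rw [hw, Finset.sum_singleton, Finset.sum_singleton, hdw] at hdef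
      have := Nat.cast_nonneg (α := ℝ) (degIn G {w} w)
      push_cast at hdef
      linarith
    have hxw0 := hx.nonneg w
    have hfar : ∀ y ∈ N, y ≠ q → W.filter (G.Adj y) = ∅ := by
      intro y hy hyq
      rw [hw, Finset.filter_singleton, if_neg]
      exact fun h => hyq (hwq y hy h.symm)
    -- Otherwise `x q ≤ ∑_I x < x w = x q / r`, against `r > 1`.
    have hqI : q ∉ I := by
      intro hqI
      have := Finset.single_le_sum (f := x) (fun y _ => hx.nonneg y) hqI
      nlinarith
    -- A vertex `i` of `I` has only the neighbour `u`, so `x i = 1/r ≥ x q / r = x w`, against `∑_I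
    -- x < x w`.
    have hIempty : I = ∅ := by
      by_contra hne
      obtain ⟨i, hi⟩ := Finset.nonempty_of_ne_empty hne
      have h1 := Finset.single_le_sum (f := x) (fun y _ => hx.nonneg y) hi
      have h2 := hIx i hi
      rw [hfar i (hmem.2 (hImem.1 hi).1) (fun h => hqI (h ▸ hi)), Finset.sum_empty,
        add_zero] at h2
      nlinarith [hx.le_one q]
    rw [hEw, hK', hIempty, Finset.card_empty] at hedges
    rw [hIempty, Finset.sum_empty, add_zero] at hsumN
    have hm : G.edgeFinset.card = 2 * L.card + 2 := by omega
    have hNL : ∀ y ∈ N, y ≠ v → y ∈ L := by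
      intro y hy hyv
      by_contra hyL
      have : y ∈ I := hImem.2 ⟨hmem.1 hy, hyv, fun h => hyL (hLmem.2 ⟨hmem.1 hy, h⟩)⟩
      rw [hIempty] at this
      exact Finset.notMem_empty _ this
    have hWw : ∀ y ∈ W, y = w := fun y hy => by rwa [hw, Finset.mem_singleton] at hy
    -- If `w` hangs at `v`, then `u` and `v` exchange roles and `G` is again extremal. If it hangs
    -- at a leaf, `u` and `v` are twins, so `x v = 1`.
    by_cases hqv : q = v
    · left
      subst hqv
      refine ⟨q, u, w, ?_, ?_, (mem_farSet.1 hwW).2, (mem_farSet.1 hwW).1, ?_⟩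
      · intro y hyq
        rcases hcases y with rfl | hy | hy
        · exact hv.symm
        · exact (hLmem.1 (hNL y hy hyq)).2
        · rw [hWw y hy]
          exact hqm.2.symm
      · intro y hyu hyw
        rcases hcases y with h | hy | hy
        · exact absurd h hyu
        · exact hmem.1 hy
        · exact absurd (hWw y hy) hyw
      · intro a b hab
        rcases hcases a with ha | ha | ha
        · exact Or.inr (Or.inl ha)
        · rcases hcases b with hb | hb | hb
          · exact Or.inr (Or.inr (Or.inr hb))
          · exact (hstar a b (hmem.1 ha) (hmem.1 hb) hab).elim Or.inl
              fun h => Or.inr (Or.inr (Or.inl h))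
          · exact Or.inl (hwq a ha (hWw b hb ▸ hab.symm))
        · rcases hcases b with hb | hb | hb
          · exact Or.inr (Or.inr (Or.inr hb))
          · exact Or.inr (Or.inr (Or.inl (hwq b hb (hWw a ha ▸ hab))))
          · exact absurd ((hWw a ha).trans (hWw b hb).symm) hab.ne
    · right
      have hqL := hNL q hqm.1 hqv
      rw [hfar v (hmem.2 hv) (Ne.symm hqv), Finset.sum_empty, add_zero] at hvx
      have hxv : x v = 1 := by
        have : (r + 1) * (x v - 1) = 0 := by linarith
        rcases mul_eq_zero.1 this with h | h <;> linarith
      have e1 : r * ∑ y ∈ L, x y = L.card * 2 + x w := by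
        have hterm : ∀ y ∈ L, r * x y = 2 + if y = q then x w else 0 := by
          intro y hy
          rw [hLx y hy, hxv]
          by_cases hyq : y = q
          · rw [if_pos hyq, hyq, hw, Finset.filter_singleton, if_pos hqm.2.symm,
              Finset.sum_singleton]
            ring
          · rw [if_neg hyq, hfar y (hmem.2 (hLmem.1 hy).1) hyq, Finset.sum_empty]
            ring
        rw [Finset.mul_sum, Finset.sum_congr rfl hterm, Finset.sum_add_distrib,
          Finset.sum_const, nsmul_eq_mul, Finset.sum_ite_eq', if_pos hqL]
      have e2 : r * x q = 2 + x w := by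
        rw [hLx q hqL, hxv, hw, Finset.filter_singleton, if_pos hqm.2.symm, Finset.sum_singleton]
        ring
      rw [hm, rhoPrimePoly]
      push_cast
      set l : ℝ := (L.card : ℝ)
      have e3 : r ^ 2 = r + 2 * l + x w := by
        have : r * r = r * (x v + ∑ y ∈ L, x y) := by rw [hsumN]
        rw [hxv] at this
        linarith
      have e4 : (r ^ 2 - 1) * x w = 2 := by
        have : r * (r * x w) = r * x q := by rw [hxw]
        linarith
      have e5 : (r + 1) * x w ≤ 1 := by
        have : (r - 1) * ((r + 1) * x w) = 2 := by linarith
        nlinarith [mul_nonneg (by linarith : (0 : ℝ) ≤ r + 1) hxw0]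
      have e6 : r ^ 4 - (2 * l + 2) * r ^ 2 - (2 * l + 2 - 2) * r + (2 * l + 2) / 2 - 1 =
          (r ^ 2 + r) * (r ^ 2 - r - 2 * l) - r ^ 2 + l := by ring
      have e7 : r ^ 2 - r - 2 * l = x w := by linarith
      rw [e6, e7]
      nlinarith

end IsPeakEigenvector

end Star

/-! ### The extremal graph: eigenvalues and uniqueness -/

section Extremal

variable {V : Type*} [Fintype V] [DecidableEq V] {G : SimpleGraph V} [DecidableRel G.Adj]

namespace IsBookWithPendant

variable {p q z : V}

theorem left_ne_right (B : IsBookWithPendant G p q z) : p ≠ q := fun h =>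
  B.not_adj (h ▸ B.adj_left z (h ▸ B.ne))

theorem pendant_ne_left (B : IsBookWithPendant G p q z) : z ≠ p := fun h =>
  B.not_adj (h ▸ (B.adj_left q B.left_ne_right.symm).symm)

theorem sum_univ (B : IsBookWithPendant G p q z) {M : Type*} [AddCommMonoid M] (g : V → M) :
    ∑ y, g y = g p + (g q + (g z + ∑ y ∈ ({p, q, z} : Finset V)ᶜ, g y)) := by
  rw [← Finset.sum_add_sum_compl {p, q, z}, Finset.sum_insert, Finset.sum_insert,
    Finset.sum_singleton]
  · abel
  · simpa using B.ne.symm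
  · simpa using ⟨B.left_ne_right, B.pendant_ne_left.symm⟩

theorem sum_left (B : IsBookWithPendant G p q z) {M : Type*} [AddCommMonoid M] (g : V → M) :
    ∑ y ∈ G.neighborFinset p, g y = g q + g z + ∑ y ∈ ({p, q, z} : Finset V)ᶜ, g y := by
  have h : G.neighborFinset p = insert q (insert z ({p, q, z} : Finset V)ᶜ) := by
    ext y
    have h1 := B.left_ne_right
    have h2 := B.pendant_ne_left
    have h3 := B.adj_left y
    have h4 : G.Adj p y → p ≠ y := fun h => h.ne
    simp only [SimpleGraph.mem_neighborFinset, Finset.mem_insert, Finset.mem_compl,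
      Finset.mem_singleton]
    grind
  rw [h, Finset.sum_insert, Finset.sum_insert, add_assoc]
  · simp
  · simpa using B.ne.symm

theorem sum_right (B : IsBookWithPendant G p q z) {M : Type*} [AddCommMonoid M] (g : V → M) :
    ∑ y ∈ G.neighborFinset q, g y = g p + ∑ y ∈ ({p, q, z} : Finset V)ᶜ, g y := by
  have h : G.neighborFinset q = insert p ({p, q, z} : Finset V)ᶜ := by
    ext y
    have h1 := B.left_ne_right
    have h2 := B.pendant_ne_left
    have h3 := B.adj_right y
    have h4 : G.Adj q y → q ≠ y := fun h => h.ne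
    have h5 := B.not_adj
    simp only [SimpleGraph.mem_neighborFinset, Finset.mem_insert, Finset.mem_compl,
      Finset.mem_singleton]
    grind
  rw [h, Finset.sum_insert]
  simp

theorem sum_pendant (B : IsBookWithPendant G p q z) {M : Type*} [AddCommMonoid M] (g : V → M) :
    ∑ y ∈ G.neighborFinset z, g y = g p := by
  have h : G.neighborFinset z = {p} := by
    ext y
    have h2 := B.pendant_ne_left
    have h3 := (B.adj_left z h2).symm
    have h4 := B.ne
    have h5 : ¬ G.Adj z q := fun h => B.not_adj h.symm
    have h6 := B.cover z y
    simp only [SimpleGraph.mem_neighborFinset, Finset.mem_singleton]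
    grind
  rw [h, Finset.sum_singleton]

theorem sum_page (B : IsBookWithPendant G p q z) {M : Type*} [AddCommMonoid M] (g : V → M)
    {y : V} (hy : y ∈ ({p, q, z} : Finset V)ᶜ) : ∑ w ∈ G.neighborFinset y, g w = g p + g q := by
  simp only [Finset.mem_compl, Finset.mem_insert, Finset.mem_singleton, not_or] at hy
  have h : G.neighborFinset y = {p, q} := by
    ext w
    have h3 := (B.adj_left y hy.1).symm
    have h4 := (B.adj_right y hy.2.1 hy.2.2).symm
    have h6 := B.cover y w
    simp only [SimpleGraph.mem_neighborFinset, Finset.mem_insert, Finset.mem_singleton]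
    grind
  rw [h, Finset.sum_pair B.left_ne_right]

theorem card_eq (B : IsBookWithPendant G p q z) :
    Fintype.card V = ({p, q, z} : Finset V)ᶜ.card + 3 := by
  have := B.sum_univ (fun _ => (1 : ℕ))
  simp only [Finset.sum_const, smul_eq_mul, mul_one, Finset.card_univ] at this
  omega

theorem card_edgeFinset (B : IsBookWithPendant G p q z) :
    G.edgeFinset.card = 2 * ({p, q, z} : Finset V)ᶜ.card + 2 := by
  have hdeg : ∀ v, G.degree v = ∑ w ∈ G.neighborFinset v, 1 := fun v => by simp
  have h1 := G.sum_degrees_eq_twice_card_edges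
  rw [B.sum_univ, hdeg p, hdeg q, hdeg z, B.sum_left, B.sum_right, B.sum_pendant,
    Finset.sum_congr rfl fun y hy => (hdeg y).trans (B.sum_page _ hy)] at h1
  simp only [Finset.sum_const, smul_eq_mul, mul_one] at h1
  omega

/-- Eliminating the pages and the pendant vertex leaves a 2×2 homogeneous system in `x p`, `x q`
whose determinant is the quartic; were it nonzero, `x` would vanish everywhere. -/
theorem rhoPrimePoly_eq_zero (B : IsBookWithPendant G p q z) {r : ℝ} {x : V → ℝ} {u : V}
    (hx : IsPeakEigenvector G r x u) (hr : 0 < r) : rhoPrimePoly G.edgeFinset.card r = 0 := by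
  have hp := hx.eig p
  have hq := hx.eig q
  have hz := hx.eig z
  rw [B.sum_left] at hp
  rw [B.sum_right] at hq
  rw [B.sum_pendant] at hz
  set R := ({p, q, z} : Finset V)ᶜ with hR
  have hy : ∀ y ∈ R, r * x y = x p + x q := fun y hy => by rw [hx.eig y, B.sum_page _ hy]
  have hs : r * ∑ y ∈ R, x y = R.card * (x p + x q) := by
    rw [Finset.mul_sum, Finset.sum_congr rfl hy, Finset.sum_const, nsmul_eq_mul]
  rw [B.card_edgeFinset, rhoPrimePoly, ← hR]
  push_cast
  set k : ℝ := (R.card : ℝ)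
  have e1 : (r ^ 2 - 1 - k) * x p = (r + k) * x q := by
    have : r * (r * x p) = r * (x q + x z + ∑ y ∈ R, x y) := by rw [hp]
    linarith
  have e2 : (r ^ 2 - k) * x q = (r + k) * x p := by
    have : r * (r * x q) = r * (x p + ∑ y ∈ R, x y) := by rw [hq]
    linarith
  have e3 : r ^ 4 - (2 * k + 2) * r ^ 2 - (2 * k + 2 - 2) * r + (2 * k + 2) / 2 - 1 =
      (r ^ 2 - k) * (r ^ 2 - 1 - k) - (r + k) ^ 2 := by ring
  rw [e3]
  by_contra hne
  have hp0 : x p = 0 := by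
    refine (mul_eq_zero.1 ?_).resolve_left hne
    linear_combination (r ^ 2 - k) * e1 + (r + k) * e2
  have hq0 : x q = 0 := by
    refine (mul_eq_zero.1 ?_).resolve_left hne
    linear_combination (r ^ 2 - 1 - k) * e2 + (r + k) * e1
  have hall : ∀ y, x y = 0 := by
    intro y
    by_cases h1 : y = p
    · rw [h1, hp0]
    by_cases h2 : y = q
    · rw [h2, hq0]
    refine (mul_eq_zero.1 (?_ : r * x y = 0)).resolve_left hr.ne'
    by_cases h3 : y = z
    · rw [h3, hz, hp0]
    · rw [hy y (by simp [hR, h1, h2, h3]), hp0, hq0, add_zero]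
  exact one_ne_zero (hx.peak ▸ hall u)

theorem le_graphSpectralRadius (B : IsBookWithPendant G p q z) {t : ℝ} (ht : 0 < t)
    (hroot : rhoPrimePoly G.edgeFinset.card t = 0) : t ≤ graphSpectralRadius G := by
  rw [B.card_edgeFinset, rhoPrimePoly] at hroot
  push_cast at hroot
  have hpq := B.left_ne_right
  have hzp := B.pendant_ne_left
  have hzq := B.ne
  set R := ({p, q, z} : Finset V)ᶜ with hR
  set k : ℝ := (R.card : ℝ) with hk
  have hk0 : 0 ≤ k := Nat.cast_nonneg _
  -- The equation at `q` fixes the ratio of the entries at `p` and `q`; the factor `t` clears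
  -- denominators in the other entries. Only the equation at `p` needs the root.
  let x : V → ℝ := fun y => if y = p then t * (t ^ 2 - k) else
    if y = q then t * (t + k) else if y = z then t ^ 2 - k else t ^ 2 + t
  have hxp : x p = t * (t ^ 2 - k) := if_pos rfl
  have hxq : x q = t * (t + k) := by simp [x, hpq.symm]
  have hxz : x z = t ^ 2 - k := by simp [x, hzp, hzq]
  have hxy : ∀ y ∈ R, x y = t ^ 2 + t := by
    intro y hy
    simp only [hR, Finset.mem_compl, Finset.mem_insert, Finset.mem_singleton, not_or] at hy
    simp [x, hy.1, hy.2.1, hy.2.2]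
  have hsum : ∑ y ∈ R, x y = k * (t ^ 2 + t) := by
    rw [Finset.sum_congr rfl hxy, Finset.sum_const, nsmul_eq_mul]
  refine le_graphSpectralRadius_of_eigenvector G (x := x) (v₀ := q) ?_ fun y => ?_
  · rw [hxq]
    exact (mul_pos ht (by linarith)).ne'
  · by_cases h1 : y = p
    · rw [h1, B.sum_left, hsum, hxp, hxq, hxz]
      linear_combination hroot
    by_cases h2 : y = q
    · rw [h2, B.sum_right, hsum, hxp, hxq]
      ring
    by_cases h3 : y = z
    · rw [h3, B.sum_pendant, hxp, hxz]
    · have hy : y ∈ R := by simp [hR, h1, h2, h3]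
      rw [B.sum_page _ hy, hxy y hy, hxp, hxq]
      ring

end IsBookWithPendant

theorem graphS2Minus_isBookWithPendant {n : ℕ} (i : Fin (n - 2)) (hi : i.val = 0) :
    IsBookWithPendant (graphS2Minus n) (Sum.inl 1) (Sum.inl 0) (Sum.inr i) := by
  have hadj : ∀ a b, (graphS2Minus n).Adj a b ↔ (graphS2 n).Adj a b ∧
      s(a, b) ≠ s(Sum.inl 0, Sum.inr i) := by
    intro a b
    rw [graphS2Minus, SimpleGraph.deleteEdges_adj]
    refine and_congr_right fun _ => not_congr ⟨?_, fun h => ⟨i, hi, h⟩⟩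
    rintro ⟨j, hj, h⟩
    rwa [Fin.ext (hi.trans hj.symm)]
  constructor
  · rintro (y | y) hy
    · rw [hadj]
      fin_cases y
      · simp [graphS2, graphJoin]
      · exact absurd rfl hy
    · simp [hadj, graphS2, graphJoin]
  · rintro (y | y) hy hyi
    · rw [hadj]
      fin_cases y
      · exact absurd rfl hy
      · simp [graphS2, graphJoin]
    · rw [hadj]
      refine ⟨by simp [graphS2, graphJoin], fun h => hyi ?_⟩
      simpa using h
  · simp [hadj]
  · simp
  · rintro (a | a) (b | b) h
    · fin_cases a <;> simp
    · fin_cases a <;> simp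
    · fin_cases b <;> simp
    · simp [hadj, graphS2, graphJoin] at h

theorem IsBookWithPendant.comap {V' : Type*} {G' : SimpleGraph V'} {p q z : V'}
    (B : IsBookWithPendant G' p q z) (φ : G ≃g G') :
    IsBookWithPendant G (φ.symm p) (φ.symm q) (φ.symm z) := by
  have hadj : ∀ a y, G.Adj (φ.symm a) y ↔ G'.Adj a (φ y) := fun a y => by
    rw [← φ.map_adj_iff, φ.apply_symm_apply]
  have heq : ∀ a y, y = φ.symm a ↔ φ y = a := fun a y =>
    φ.toEquiv.eq_symm_apply
  refine ⟨fun y hy => ?_, fun y hy hz => ?_, ?_, ?_, fun a b h => ?_⟩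
  · rw [hadj]
    exact B.adj_left _ fun h => hy ((heq _ _).2 h)
  · rw [hadj]
    exact B.adj_right _ (fun h => hy ((heq _ _).2 h)) fun h => hz ((heq _ _).2 h)
  · rw [hadj, φ.apply_symm_apply]
    exact B.not_adj
  · exact fun h => B.ne (φ.symm.injective h)
  · simp only [heq]
    exact B.cover _ _ (φ.map_adj_iff.2 h)

theorem IsBookWithPendant.adj_iff {p q z : V} (B : IsBookWithPendant G p q z) (a b : V) :
    G.Adj a b ↔ a ≠ b ∧ ((a = p ∨ b = p) ∨ (a = q ∧ b ≠ z) ∨ (b = q ∧ a ≠ z)) := by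
  constructor
  · intro h
    refine ⟨h.ne, ?_⟩
    have haz : a = q → b ≠ z := fun h1 h2 => B.not_adj (h1 ▸ h2 ▸ h)
    have hbz : b = q → a ≠ z := fun h1 h2 => B.not_adj (h1 ▸ h2 ▸ h.symm)
    rcases B.cover a b h with h | h | h | h
    · exact Or.inl (Or.inl h)
    · exact Or.inr (Or.inl ⟨h, haz h⟩)
    · exact Or.inl (Or.inr h)
    · exact Or.inr (Or.inr ⟨h, hbz h⟩)
  · rintro ⟨hab, (rfl | rfl) | ⟨rfl, h⟩ | ⟨rfl, h⟩⟩
    · exact B.adj_left b hab.symm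
    · exact (B.adj_left a hab).symm
    · exact B.adj_right b hab.symm h
    · exact (B.adj_right a hab h).symm

/-- By `adj_iff` the three named vertices determine all adjacencies, so any bijection matching them
is an isomorphism. -/
theorem IsBookWithPendant.nonempty_iso {V' : Type*} [Fintype V'] [DecidableEq V']
    {G' : SimpleGraph V'} {p q z : V} {p' q' z' : V'} (B : IsBookWithPendant G p q z)
    (B' : IsBookWithPendant G' p' q' z') (hcard : Fintype.card V = Fintype.card V') :
    Nonempty (G ≃g G') := by
  classical
  have h1 : ({p, q, z} : Finset V)ᶜ.card = ({p', q', z'} : Finset V')ᶜ.card := by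
    have := B.card_eq
    have := B'.card_eq
    omega
  have hpq := B.left_ne_right
  have hzp := B.pendant_ne_left
  have hzq := B.ne
  have hpq' := B'.left_ne_right
  have hzp' := B'.pendant_ne_left
  have hzq' := B'.ne
  let e := Finset.equivOfCardEq h1
  have hmem : ∀ y, y ∈ ({p, q, z} : Finset V)ᶜ ↔ y ≠ p ∧ y ≠ q ∧ y ≠ z := by simp
  have hmem' : ∀ y, y ∈ ({p', q', z'} : Finset V')ᶜ ↔ y ≠ p' ∧ y ≠ q' ∧ y ≠ z' := by simp
  let f : V → V' := fun y => if y = p then p' else if y = q then q' else if y = z then z' else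
    if h : y ∈ ({p, q, z} : Finset V)ᶜ then (e ⟨y, h⟩ : V') else p'
  have hfp : f p = p' := if_pos rfl
  have hfq : f q = q' := by simp [f, hpq.symm]
  have hfz : f z = z' := by simp [f, hzp, hzq]
  have hfy : ∀ y (h : y ∈ ({p, q, z} : Finset V)ᶜ), f y = e ⟨y, h⟩ := by
    intro y h
    obtain ⟨a, b, c⟩ := (hmem y).1 h
    simp only [f, if_neg a, if_neg b, if_neg c, dif_pos h]
  have hfin : ∀ y, y ≠ p → y ≠ q → y ≠ z → f y ≠ p' ∧ f y ≠ q' ∧ f y ≠ z' := by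
    intro y a b c
    rw [hfy y ((hmem y).2 ⟨a, b, c⟩), ← hmem']
    exact (e _).2
  have hip : ∀ y, f y = p' ↔ y = p := by intro y; grind
  have hiq : ∀ y, f y = q' ↔ y = q := by intro y; grind
  have hiz : ∀ y, f y = z' ↔ y = z := by intro y; grind
  have hinj : Function.Injective f := by
    intro a b hab
    by_cases a1 : a = p
    · rw [a1, hfp] at hab
      rw [a1, (hip b).1 hab.symm]
    by_cases a2 : a = q
    · rw [a2, hfq] at hab
      rw [a2, (hiq b).1 hab.symm]
    by_cases a3 : a = z
    · rw [a3, hfz] at hab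
      rw [a3, (hiz b).1 hab.symm]
    have ha := (hmem a).2 ⟨a1, a2, a3⟩
    have hb : b ∈ ({p, q, z} : Finset V)ᶜ := by
      rw [hmem, Ne, Ne, Ne, ← hip, ← hiq, ← hiz, ← hab]
      exact hfin a a1 a2 a3
    rw [hfy a ha, hfy b hb] at hab
    simpa using e.injective (Subtype.ext hab)
  have hbij : Function.Bijective f := (Fintype.bijective_iff_injective_and_card f).2 ⟨hinj, hcard⟩
  refine ⟨⟨Equiv.ofBijective f hbij, fun {a b} => ?_⟩⟩
  change G'.Adj (f a) (f b) ↔ G.Adj a b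
  rw [B.adj_iff, B'.adj_iff, Ne, Ne, Ne, hip, hip, hiq, hiq, hiz, hiz, hinj.eq_iff]

end Extremal

/-! ### Estimates for the largest root -/

section RhoPrime

theorem rhoPrimePoly_nonneg_of_rhoPrime_le {m : ℕ} (hm : 2 ≤ m) {t : ℝ} (ht : rhoPrime m ≤ t) :
    0 ≤ rhoPrimePoly m t := by
  by_contra! hneg
  have hgr := rhoPrime_isGreatest m hm
  have hm' : (2 : ℝ) ≤ m := by exact_mod_cast hm
  -- At `b ≥ 2m` the leading term dominates, so a negative value at `t` would produce a root beyond
  -- `ρ'(m)`.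
  set b : ℝ := max t (2 * m) with hb
  have htb : t ≤ b := le_max_left _ _
  have hmb : 2 * (m : ℝ) ≤ b := le_max_right _ _
  have hpos : 0 ≤ rhoPrimePoly m b := by
    have h1 : (m : ℝ) * b ^ 2 ≤ b / 2 * b ^ 2 := by gcongr; linarith
    have h2 : ((m : ℝ) - 2) * b ≤ b / 2 * b := by gcongr; linarith
    have h3 : 0 ≤ b ^ 2 * (b - 4) * (b + 3) := by
      have : 0 ≤ b - 4 := by linarith
      have : 0 ≤ b + 3 := by linarith
      positivity
    rw [rhoPrimePoly]
    nlinarith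
  obtain ⟨c, hc, hc0⟩ := intermediate_value_Icc htb
    (show ContinuousOn (fun y : ℝ => rhoPrimePoly m y) (Set.Icc t b) by
      unfold rhoPrimePoly; fun_prop) (show (0 : ℝ) ∈ Set.Icc _ _ from ⟨hneg.le, hpos⟩)
  have hcr : c ≤ rhoPrime m := hgr.2 hc0
  have : t = c := le_antisymm hc.1 (hcr.trans ht)
  rw [← this] at hc0
  exact hneg.ne hc0

theorem le_rhoPrime_of_root {m : ℕ} (hm : 2 ≤ m) {t : ℝ} (h : rhoPrimePoly m t = 0) :
    t ≤ rhoPrime m := (rhoPrime_isGreatest m hm).2 h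

/-- The positive root `θ` of `θ² - θ = m - 2` makes the quartic equal to `-θ - (m - 2)/2 < 0`, so `θ
< ρ'(m)`. For `m ≥ 38`, `4m - 7 ≥ 145 > 12²`, whence `θ > 13/2`. -/
theorem rhoPrime_gap {m : ℕ} (hm : 38 ≤ m) {t : ℝ} (ht : rhoPrime m ≤ t) :
    13 / 2 < t ∧ (m : ℝ) - 2 < t ^ 2 - t := by
  have hm' : (38 : ℝ) ≤ m := by exact_mod_cast hm
  have hs := Real.sq_sqrt (show (0 : ℝ) ≤ 4 * m - 7 by linarith)
  have h12 : 12 < √(4 * (m : ℝ) - 7) := Real.lt_sqrt_of_sq_lt (by linarith)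
  set θ := (1 + √(4 * (m : ℝ) - 7)) / 2 with hθ
  have hθ6 : 13 / 2 < θ := by linarith
  have hθsq : θ ^ 2 = θ + m - 2 := by rw [hθ]; linarith
  have hlt : θ < rhoPrime m := by
    by_contra! h
    have := rhoPrimePoly_nonneg_of_rhoPrime_le (by omega) h
    have h4 : θ ^ 4 = (θ + m - 2) ^ 2 := by rw [← hθsq]; ring
    rw [rhoPrimePoly, h4] at this
    nlinarith
  have hθt : θ < t := hlt.trans_le ht
  refine ⟨hθ6.trans hθt, ?_⟩
  nlinarith

end RhoPrime

/-! ### Conclusion -/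

theorem isBookWithPendant_of_rhoPrime_le {V : Type*} [Fintype V] [DecidableEq V]
    {G : SimpleGraph V} [DecidableRel G.Adj] (heven : Even G.edgeFinset.card)
    (hm : 38 ≤ G.edgeFinset.card) (hfree : graphH43.Free G) (hiso : ∀ v : V, ¬ G.IsIsolated v)
    (hle : rhoPrime G.edgeFinset.card ≤ graphSpectralRadius G) :
    (∃ p q z, IsBookWithPendant G p q z) ∧
      graphSpectralRadius G = rhoPrime G.edgeFinset.card := by
  have : Nonempty V := by
    obtain ⟨e, -⟩ := Finset.card_pos.1 (show 0 < G.edgeFinset.card by omega)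
    induction e with | _ a b => exact ⟨a⟩
  obtain ⟨x, u, hx⟩ := exists_isPeakEigenvector G
  obtain ⟨hr, hgap⟩ := rhoPrime_gap hm hle
  obtain ⟨v, hv, h4⟩ := hx.exists_four_le_degIn hfree hgap hr
  have hbook : ∃ p q z, IsBookWithPendant G p q z :=
    (hx.isBookWithPendant_or_of_four_le hfree hgap hr heven
      (fun v => SimpleGraph.exists_adj_iff_not_isIsolated.2 (hiso v))
      ((G.mem_neighborFinset u v).1 hv) h4).resolve_right
      (not_lt.2 (rhoPrimePoly_nonneg_of_rhoPrime_le (by omega) hle))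
  refine ⟨hbook, le_antisymm ?_ hle⟩
  obtain ⟨p, q, z, B⟩ := hbook
  exact le_rhoPrime_of_root (by omega) (B.rhoPrimePoly_eq_zero hx (by linarith))

theorem theorem1p1 {V : Type*} [Fintype V] [DecidableEq V] (G : SimpleGraph V)
    [DecidableRel G.Adj] (m : ℕ) (hsize : G.edgeFinset.card = m) (heven : Even m) (hm : 38 ≤ m)
    (hfree : graphH43.Free G) (hiso : ∀ v : V, ¬ G.IsIsolated v) :
    graphSpectralRadius G ≤ rhoPrime m ∧
      (graphSpectralRadius G = rhoPrime m ↔ Nonempty (G ≃g graphS2Minus ((m + 4) / 2))) := by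
  subst hsize
  have main := isBookWithPendant_of_rhoPrime_le heven hm hfree hiso
  have hS := graphS2Minus_isBookWithPendant (n := (G.edgeFinset.card + 4) / 2)
    ⟨0, by omega⟩ rfl
  refine ⟨?_, fun h => ?_, ?_⟩
  · rcases le_total (graphSpectralRadius G) (rhoPrime G.edgeFinset.card) with h | h
    · exact h
    · exact (main h).2.le
  · obtain ⟨p, q, z, B⟩ := (main h.ge).1
    refine B.nonempty_iso hS ?_
    have h1 := B.card_edgeFinset
    have h2 := B.card_eq
    rw [Fintype.card_sum, Fintype.card_fin, Fintype.card_fin]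
    omega
  · rintro ⟨φ⟩
    -- Only the lower bound from the explicit eigenvector is needed here; `main` upgrades it to
    -- equality.
    refine (main ((hS.comap φ).le_graphSpectralRadius ?_ ?_)).2
    · have := (rhoPrime_gap hm le_rfl).1
      linarith
    · exact (rhoPrime_isGreatest _ (by omega)).1
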